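/- For $i=1,\dots,11$ let $N^{8,3}_i$ be the complex Lie algebra with basis $x_1,\dots,x_5,y_1,y_2,y_3$ whose Lie bracket is determined by the following relations; all brackets of basis elements that do not follow from the listed ones by antisymmetry are zero. - $N^{8,3}_1$: $[x_1,x_2]=[x_3,x_4]=y_1,\ [x_3,x_5]=y_2,\ [x_4,x_5]=y_3$. - $N^{8,3}_2$: $[x_1,x_5]=[x_4,x_2]=y_1,\ [x_5,x_3]=y_2,\ [x_3,x_4]=y_3$. - $N^{8,3}_3$: $[x_5,x_3]=[x_3,x_4]=y_1,\ [x_1,x_5]=y_2,\ [x_2,x_4]=y_3$. - $N^{8,3}_4$: $[x_1,x_5]=[x_3,x_4]=y_1,\ [x_5,x_3]=y_2,\ [x_2,x_4]=y_3$. - $N^{8,3}_5$: $[x_1,x_4]=[x_5,x_2]=y_1,\ [x_3,x_5]=y_2,\ [x_4,x_5]=y_3$. - $N^{8,3}_6$: $[x_1,x_2]=[x_5,x_4]=y_1,\ [x_2,x_5]=[x_4,x_3]=y_2,\ [x_3,x_5]=y_3$. - $N^{8,3}_7$: $[x_1,x_2]=[x_5,x_3]=y_1,\ [x_2,x_5]=[x_5,x_4]=y_2,\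 [x_3,x_4]=y_3$. - $N^{8,3}_8$: $[x_1,x_5]=[x_3,x_4]=y_1,\ [x_3,x_5]=[x_2,x_4]=y_2,\ [x_4,x_5]=y_3$. - $N^{8,3}_9$: $[x_1,x_5]=[x_3,x_2]=y_1,\ [x_3,x_5]=[x_2,x_4]=y_2,\ [x_4,x_5]=y_3$. - $N^{8,3}_{10}$: $[x_1,x_2]=[x_3,x_4]=y_1,\ [x_2,x_3]=[x_4,x_5]=y_2,\ [x_1,x_5]=y_3$. - $N^{8,3}_{11}$: $[x_1,x_5]=[x_4,x_2]=y_1,\ [x_1,x_4]=[x_5,x_3]=y_2,\ [x_4,x_5]=[x_2,x_3]=y_3$. Then each $N^{8,3}_i$ is an $8$-dimensional two-step nilpotent Lie algebra with $3$-dimensional center, and these eleven Lie algebras are mutually non-isomorphic: for $i\neq j$ there is no isomorphism of complex Lie algebras $N^{8,3}_i\cong N^{8,3}_j$. -/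

import Mathlib

/-- The underlying space `ℂ^q ⊕ ℂ^p` of the two-step nilpotent Lie algebra with generators
`x_1, …, x_q`, central elements `y_1, …, y_p` (together a basis), and bracket given by a list
of relations: an entry `(i, j, k)` of the list `R` stands for the relation `[x_i, x_j] = y_k`,
and the brackets `[x_i, x_j]` that are not determined by the list (and antisymmetry), as well
as all brackets involving some `y_k`, are zero. (In the lists below no pair of generators
occurs twice; in general repeated entries for the same pair would be added.) -/
def TwoStep (q p : ℕ) (_R : List (Fin q × Fin q × Fin p)) : Type :=
  (Fin q → ℂ) × (Fin p → ℂ)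

namespace TwoStep

variable {q p : ℕ} {R : List (Fin q × Fin q × Fin p)}

instance : AddCommGroup (TwoStep q p R) :=
  inferInstanceAs (AddCommGroup ((Fin q → ℂ) × (Fin p → ℂ)))

instance : Module ℂ (TwoStep q p R) :=
  inferInstanceAs (Module ℂ ((Fin q → ℂ) × (Fin p → ℂ)))

/-- The bilinear extension of the relations: the entry `(i, j, k)` contributes
`(u_i v_j - u_j v_i) y_k` to the bracket of `u` and `v`. -/
def bracket (u v : TwoStep q p R) : TwoStep q p R :=
  (0, fun k => (R.map fun r =>
    if r.2.2 = k then u.1 r.1 * v.1 r.2.1 - u.1 r.2.1 * v.1 r.1 else 0).sum)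

instance : Bracket (TwoStep q p R) (TwoStep q p R) := ⟨bracket⟩

theorem lie_fst (u v : TwoStep q p R) : (⁅u, v⁆ : TwoStep q p R).1 = 0 := rfl

theorem lie_snd (u v : TwoStep q p R) (k : Fin p) :
    (⁅u, v⁆ : TwoStep q p R).2 k = (R.map fun r =>
      if r.2.2 = k then u.1 r.1 * v.1 r.2.1 - u.1 r.2.1 * v.1 r.1 else 0).sum := rfl

theorem ext' {u v : TwoStep q p R} (h₁ : u.1 = v.1) (h₂ : ∀ k, u.2 k = v.2 k) : u = v :=
  Prod.ext h₁ (funext h₂)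

theorem add_fst (u v : TwoStep q p R) : (u + v).1 = u.1 + v.1 := rfl

theorem add_snd (u v : TwoStep q p R) : (u + v).2 = u.2 + v.2 := rfl

theorem smul_fst (c : ℂ) (u : TwoStep q p R) : (c • u).1 = c • u.1 := rfl

theorem smul_snd (c : ℂ) (u : TwoStep q p R) : (c • u).2 = c • u.2 := rfl

theorem zero_fst : (0 : TwoStep q p R).1 = 0 := rfl

theorem zero_snd : (0 : TwoStep q p R).2 = 0 := rfl

theorem lie_lie_zero (u v w : TwoStep q p R) : ⁅u, ⁅v, w⁆⁆ = 0 := by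
  refine ext' rfl fun k => ?_
  rw [lie_snd, lie_fst, zero_snd]
  simp

instance : LieRing (TwoStep q p R) where
  add_lie u v w := by
    refine ext' (by simp [lie_fst, add_fst]) fun k => ?_
    rw [add_snd, Pi.add_apply, lie_snd, lie_snd, lie_snd, ← List.sum_map_add]
    congr 1
    refine List.map_congr_left fun r _ => ?_
    split_ifs
    · simp only [add_fst, Pi.add_apply]; ring
    · simp
  lie_add u v w := by
    refine ext' (by simp [lie_fst, add_fst]) fun k => ?_
    rw [add_snd, Pi.add_apply, lie_snd, lie_snd, lie_snd, ← List.sum_map_add]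
    congr 1
    refine List.map_congr_left fun r _ => ?_
    split_ifs
    · simp only [add_fst, Pi.add_apply]; ring
    · simp
  lie_self u := by
    refine ext' rfl fun k => ?_
    rw [lie_snd, zero_snd]
    simp [mul_comm]
  leibniz_lie u v w := by
    have h : ⁅⁅u, v⁆, w⁆ = 0 := by
      refine ext' rfl fun k => ?_
      rw [lie_snd, lie_fst, zero_snd]
      simp
    rw [lie_lie_zero, lie_lie_zero, h, add_zero]

instance : LieAlgebra ℂ (TwoStep q p R) where
  lie_smul c u v := by
    refine ext' (by simp [lie_fst, smul_fst]) fun k => ?_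
    rw [smul_snd, Pi.smul_apply, lie_snd, lie_snd, smul_eq_mul, ← List.sum_map_mul_left]
    congr 1
    refine List.map_congr_left fun r _ => ?_
    split_ifs
    · simp only [smul_fst, Pi.smul_apply, smul_eq_mul]; ring
    · simp

end TwoStep

namespace N83

/-! Names for the indices of the generators `x_1, …, x_5` and of the central basis
`y_1, y_2, y_3`. -/

abbrev x₁ : Fin 5 := 0
abbrev x₂ : Fin 5 := 1
abbrev x₃ : Fin 5 := 2
abbrev x₄ : Fin 5 := 3
abbrev x₅ : Fin 5 := 4
abbrev y₁ : Fin 3 := 0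
abbrev y₂ : Fin 3 := 1
abbrev y₃ : Fin 3 := 2

/-- The defining relations; the value at `i : Fin 11` is the list for the algebra number
`i + 1`, and `(x₁, x₂, y₁)` is the relation `[x_1, x_2] = y_1`. -/
def relations : Fin 11 → List (Fin 5 × Fin 5 × Fin 3) :=
  ![ -- algebra 1
    [(x₁, x₂, y₁), (x₃, x₄, y₁), (x₃, x₅, y₂), (x₄, x₅, y₃)],
    -- algebra 2
    [(x₁, x₅, y₁), (x₄, x₂, y₁), (x₅, x₃, y₂), (x₃, x₄, y₃)],
    -- algebra 3
    [(x₅, x₃, y₁), (x₃, x₄, y₁), (x₁, x₅, y₂), (x₂, x₄, y₃)],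
    -- algebra 4
    [(x₁, x₅, y₁), (x₃, x₄, y₁), (x₅, x₃, y₂), (x₂, x₄, y₃)],
    -- algebra 5
    [(x₁, x₄, y₁), (x₅, x₂, y₁), (x₃, x₅, y₂), (x₄, x₅, y₃)],
    -- algebra 6
    [(x₁, x₂, y₁), (x₅, x₄, y₁), (x₂, x₅, y₂), (x₄, x₃, y₂), (x₃, x₅, y₃)],
    -- algebra 7
    [(x₁, x₂, y₁), (x₅, x₃, y₁), (x₂, x₅, y₂), (x₅, x₄, y₂), (x₃, x₄, y₃)],
    -- algebra 8
    [(x₁, x₅, y₁), (x₃, x₄, y₁), (x₃, x₅, y₂), (x₂, x₄, y₂), (x₄, x₅, y₃)],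
    -- algebra 9
    [(x₁, x₅, y₁), (x₃, x₂, y₁), (x₃, x₅, y₂), (x₂, x₄, y₂), (x₄, x₅, y₃)],
    -- algebra 10
    [(x₁, x₂, y₁), (x₃, x₄, y₁), (x₂, x₃, y₂), (x₄, x₅, y₂), (x₁, x₅, y₃)],
    -- algebra 11
    [(x₁, x₅, y₁), (x₄, x₂, y₁), (x₁, x₄, y₂), (x₅, x₃, y₂), (x₄, x₅, y₃), (x₂, x₃, y₃)]]

end N83

/-- The eleven Lie algebras `N^{8,3}_1, …, N^{8,3}_11` over `ℂ`; `N83 i` is the one with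
number `i + 1`. -/
abbrev N83 (i : Fin 11) : Type := TwoStep 5 3 (N83.relations i)

/-! Composing the bracket with linear functionals `t` gives a space of alternating forms on the
five-dimensional span of the generators. Every `y k` is itself a bracket, so this space is a net
with coordinates (a, b, c) = (t y_1, t y_2, t y_3), and an isomorphism of Lie algebras carries one
net to the other.

The main invariant is the scheme in the projective plane where the form has rank two. It is cut out
by `t ∧ t = 0`, that is, by the 4×4 Pfaffians, which are quadrics in a, b, c. For `N83 i` it is: a
line (i = 0, 1); a line with an embedded point (4); three reduced points (2); a double and a reduced
point (3); two reduced points (6); a curvilinear double point (5); a fat triple point (7); a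
curvilinear triple point (8); one reduced point (9); empty (10).

These shapes are told apart by elementary conditions on `t ∧ s`: existence of points, two points, a
line, a tangent vector, a vertex, a second-order arc, and whether the points span the plane. The
algebras 0 and 1 have the same Pfaffian ideal (a², ab, ac); there the elements with adjoint map of
rank at most one decide. -/

namespace TwoStep

/-! ### Coordinates, center and nilpotency length of a two-step algebra -/

variable {q p : ℕ} {R : List (Fin q × Fin q × Fin p)}

/-- The generator `x_i`. -/
def x (i : Fin q) : TwoStep q p R := (Pi.single i 1, 0)

/-- The central basis vector `y_k`. -/
def y (k : Fin p) : TwoStep q p R := (0, Pi.single k 1)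

theorem x_fst (i j : Fin q) : (x i : TwoStep q p R).1 j = if j = i then 1 else 0 :=
  Pi.single_apply i 1 j

theorem y_snd (k m : Fin p) : (y k : TwoStep q p R).2 m = if m = k then 1 else 0 :=
  Pi.single_apply k 1 m

theorem y_ne_zero (k : Fin p) : (y k : TwoStep q p R) ≠ 0 := fun h => by
  simpa [zero_snd, h] using y_snd (R := R) k k

theorem list_sum_fst (l : List (TwoStep q p R)) : l.sum.1 = (l.map fun u => u.1).sum := by
  induction l with
  | nil => rfl
  | cons a l ih => simp [add_fst, ih]

theorem list_sum_snd (l : List (TwoStep q p R)) (k : Fin p) :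
    l.sum.2 k = (l.map fun u => u.2 k).sum := by
  induction l with
  | nil => rfl
  | cons a l ih => simp [add_snd, ih]

theorem lie_eq_sum (u v : TwoStep q p R) :
    ⁅u, v⁆ = (R.map fun r => (u.1 r.1 * v.1 r.2.1 - u.1 r.2.1 * v.1 r.1) • y r.2.2).sum := by
  refine ext' ?_ fun k => ?_
  · rw [lie_fst, list_sum_fst, eq_comm]
    refine List.sum_eq_zero fun w hw => ?_
    simp only [List.map_map, List.mem_map] at hw
    obtain ⟨r, -, rfl⟩ := hw
    exact smul_zero _
  · rw [lie_snd, list_sum_snd, List.map_map]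
    congr 1
    refine List.map_congr_left fun r _ => ?_
    simp only [Function.comp_apply, smul_snd]
    simp [y, Pi.single_apply, eq_comm]

theorem apply_lie (t : TwoStep q p R →ₗ[ℂ] ℂ) (u v : TwoStep q p R) :
    t ⁅u, v⁆ =
      (R.map fun r => t (y r.2.2) * (u.1 r.1 * v.1 r.2.1 - u.1 r.2.1 * v.1 r.1)).sum := by
  rw [lie_eq_sum, map_list_sum, List.map_map]
  congr 1
  refine List.map_congr_left fun r _ => ?_
  simp [mul_comm]

/-- The linear functional that vanishes on the generators and has prescribed values on the
central basis. -/
def functional (a : Fin p → ℂ) : TwoStep q p R →ₗ[ℂ] ℂ where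
  toFun u := ∑ k, a k * u.2 k
  map_add' u v := by simp [add_snd, mul_add, Finset.sum_add_distrib]
  map_smul' c u := by simp [smul_snd, Finset.mul_sum, mul_left_comm]

theorem functional_y (a : Fin p → ℂ) (k : Fin p) :
    functional (R := R) a (y k) = a k := by
  simp [functional, y, Pi.single_apply]

theorem finrank_eq : Module.finrank ℂ (TwoStep q p R) = q + p :=
  (Module.finrank_prod (R := ℂ) (M := Fin q → ℂ) (M' := Fin p → ℂ)).trans (by simp)

theorem mem_center_of_fst_eq_zero {u : TwoStep q p R} (hu : u.1 = 0) :
    u ∈ LieAlgebra.center ℂ (TwoStep q p R) := by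
  rw [LieModule.mem_maxTrivSubmodule]
  intro v
  refine ext' rfl fun k => ?_
  rw [lie_snd, hu, zero_snd]
  simp

theorem finrank_center
    (h : ∀ u : TwoStep q p R, (∀ v : TwoStep q p R, ⁅v, u⁆ = 0) → u.1 = 0) :
    Module.finrank ℂ (LieAlgebra.center ℂ (TwoStep q p R)) = p := by
  let f : (Fin p → ℂ) →ₗ[ℂ] TwoStep q p R := LinearMap.inr ℂ (Fin q → ℂ) (Fin p → ℂ)
  have hf : Function.Injective f := LinearMap.inr_injective
  have hr : (LieAlgebra.center ℂ (TwoStep q p R)).toSubmodule = LinearMap.range f := by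
    ext u
    constructor
    · intro hu
      exact ⟨u.2, Prod.ext (h u ((LieModule.mem_maxTrivSubmodule ..).1 hu)).symm rfl⟩
    · rintro ⟨w, rfl⟩
      exact mem_center_of_fst_eq_zero rfl
  have : Module.finrank ℂ (LinearMap.range f) = p := by
    rw [LinearMap.finrank_range_of_inj hf]; simp
  rw [← hr] at this
  exact this

/-- Brackets have no generator component, hence are central, so the second term of the lower central
series vanishes; a nonzero bracket keeps the first term alive. -/
theorem nilpotencyLength_eq_two (h : ∃ u v : TwoStep q p R, ⁅u, v⁆ ≠ 0) :
    LieModule.nilpotencyLength (TwoStep q p R) (TwoStep q p R) = 2 := by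
  obtain ⟨u, v, huv⟩ := h
  rw [LieModule.nilpotencyLength_eq_succ_iff ℂ]
  constructor
  · rw [LieModule.lowerCentralSeries_succ, LieSubmodule.lie_eq_bot_iff]
    intro a _ b hb
    rw [LieModule.lowerCentralSeries_succ] at hb
    revert hb b
    suffices ⁅(⊤ : LieIdeal ℂ (TwoStep q p R)),
        LieModule.lowerCentralSeries ℂ (TwoStep q p R) (TwoStep q p R) 0⁆ ≤
        LieAlgebra.center ℂ (TwoStep q p R) from
      fun b hb => (LieModule.mem_maxTrivSubmodule ..).1 (this hb) a
    rw [LieSubmodule.lieIdeal_oper_eq_span, LieSubmodule.lieSpan_le]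
    rintro _ ⟨c, d, rfl⟩
    exact mem_center_of_fst_eq_zero rfl
  · intro hbot
    have : ⁅u, v⁆ ∈ LieModule.lowerCentralSeries ℂ (TwoStep q p R) (TwoStep q p R) 1 := by
      rw [LieModule.lowerCentralSeries_succ]
      exact LieSubmodule.lie_mem_lie (LieSubmodule.mem_top u) (by simp)
    rw [hbot] at this
    exact huv this

end TwoStep

namespace N83

open TwoStep

theorem fst_eq_zero_of_lie_eq_zero (i : Fin 11) (u : N83 i)
    (h : ∀ v : N83 i, ⁅v, u⁆ = 0) : u.1 = 0 := by
  -- Brackets with the generators alone give linear equations that already force all five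
  -- coordinates of `u` to vanish.
  have H : ∀ (j : Fin 5) (k : Fin 3), (⁅(x j : N83 i), u⁆ : N83 i).2 k = 0 := by
    intro j k; rw [h]; rfl
  simp only [lie_snd, x_fst] at H
  ext m
  fin_cases i <;> simp [relations, x₁, x₂, x₃, x₄, x₅, y₁, y₂, y₃, Fin.forall_fin_succ] at H <;>
    fin_cases m <;> simp [H]

theorem exists_lie_ne_zero (i : Fin 11) : ∃ u v : N83 i, ⁅u, v⁆ ≠ 0 := by
  by_contra! h
  have := congrFun (N83.fst_eq_zero_of_lie_eq_zero i (x 0) fun v => h v _) 0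
  simp [x_fst] at this

end N83

/-! ### Isomorphism invariants of the net of bracket forms -/

namespace BracketForm

variable {L M : Type*} [LieRing L] [LieAlgebra ℂ L] [LieRing M] [LieAlgebra ℂ M]

/-- The value at `(u, v, w, z)` of the wedge product of the alternating forms `t ⁅·, ·⁆` and
`s ⁅·, ·⁆`. -/
def wedge (t s : L →ₗ[ℂ] ℂ) (u v w z : L) : ℂ :=
  t ⁅u, v⁆ * s ⁅w, z⁆ + s ⁅u, v⁆ * t ⁅w, z⁆ - t ⁅u, w⁆ * s ⁅v, z⁆ - s ⁅u, w⁆ * t ⁅v, z⁆ +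
    t ⁅u, z⁆ * s ⁅v, w⁆ + s ⁅u, z⁆ * t ⁅v, w⁆

/-- The forms `t ⁅·, ·⁆` and `s ⁅·, ·⁆` have zero wedge product. For `t = s` this says that
the form has rank at most two. -/
def WedgeZero (t s : L →ₗ[ℂ] ℂ) : Prop := ∀ u v w z : L, wedge t s u v w z = 0

/-- The forms `t ⁅·, ·⁆` and `s ⁅·, ·⁆` are linearly independent. -/
def Indep (t s : L →ₗ[ℂ] ℂ) : Prop :=
  ∀ α β : ℂ, (∀ u v : L, α * t ⁅u, v⁆ + β * s ⁅u, v⁆ = 0) → α = 0 ∧ β = 0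

/-- The form `t ⁅·, ·⁆` is not zero. -/
def Nonzero (t : L →ₗ[ℂ] ℂ) : Prop := ∃ u v : L, t ⁅u, v⁆ ≠ 0

/-- Pulling back a functional along an isomorphism. -/
def pull (e : L ≃ₗ⁅ℂ⁆ M) (t : M →ₗ[ℂ] ℂ) : L →ₗ[ℂ] ℂ := t ∘ₗ (e : L →ₗ[ℂ] M)

theorem pull_lie (e : L ≃ₗ⁅ℂ⁆ M) (t : M →ₗ[ℂ] ℂ) (u v : L) :
    pull e t ⁅u, v⁆ = t ⁅e u, e v⁆ :=
  congrArg t (e.toLieHom.map_lie u v)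

theorem pull_pull_symm (e : L ≃ₗ⁅ℂ⁆ M) (t : L →ₗ[ℂ] ℂ) : pull e (pull e.symm t) = t :=
  LinearMap.ext fun u => congrArg t (e.symm_apply_apply u)

theorem wedge_pull (e : L ≃ₗ⁅ℂ⁆ M) (t s : M →ₗ[ℂ] ℂ) (u v w z : L) :
    wedge (pull e t) (pull e s) u v w z = wedge t s (e u) (e v) (e w) (e z) := by
  simp only [wedge, pull_lie]

theorem WedgeZero.pull (e : L ≃ₗ⁅ℂ⁆ M) {t s : M →ₗ[ℂ] ℂ} (h : WedgeZero t s) :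
    WedgeZero (pull e t) (pull e s) := fun u v w z => by
  rw [wedge_pull]; exact h _ _ _ _

theorem Nonzero.pull (e : L ≃ₗ⁅ℂ⁆ M) {t : M →ₗ[ℂ] ℂ} (h : Nonzero t) :
    Nonzero (pull e t) := by
  obtain ⟨u, v, h⟩ := h
  exact ⟨e.symm u, e.symm v, by rwa [pull_lie, e.apply_symm_apply, e.apply_symm_apply]⟩

theorem Indep.pull (e : L ≃ₗ⁅ℂ⁆ M) {t s : M →ₗ[ℂ] ℂ} (h : Indep t s) :
    Indep (pull e t) (pull e s) := fun α β hαβ => h α β fun u v => by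
  simpa only [pull_lie, e.apply_symm_apply] using hαβ (e.symm u) (e.symm v)

theorem map_lie_ne_zero (e : L ≃ₗ⁅ℂ⁆ M) {u v : L} (h : ⁅u, v⁆ ≠ 0) : ⁅e u, e v⁆ ≠ 0 := by
  rw [← LieEquiv.map_lie]
  exact fun h0 => h (e.injective (h0.trans e.toLieHom.map_zero.symm))

theorem Indep.symm {t s : L →ₗ[ℂ] ℂ} (h : Indep t s) : Indep s t := fun α β hαβ =>
  (h β α fun u v => by rw [add_comm]; exact hαβ u v).symm

variable (L)

/-- Some nonzero form has rank two. -/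
def HasRankTwo : Prop := ∃ t : L →ₗ[ℂ] ℂ, Nonzero t ∧ WedgeZero t t

/-- Two independent forms have rank two. -/
def HasTwoRankTwo : Prop :=
  ∃ t s : L →ₗ[ℂ] ℂ, Indep t s ∧ WedgeZero t t ∧ WedgeZero s s

/-- There is a pencil of forms of rank two. -/
def HasPencil : Prop :=
  ∃ t s : L →ₗ[ℂ] ℂ, Indep t s ∧ WedgeZero t t ∧ WedgeZero s s ∧ WedgeZero t s

/-- Some form of rank two has an independent tangent direction in the rank two locus. -/
def HasTangent : Prop :=
  ∃ t s : L →ₗ[ℂ] ℂ, Indep t s ∧ WedgeZero t t ∧ WedgeZero t s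

/-- Some nonzero form has zero wedge product with all forms. -/
def HasApex : Prop := ∃ t : L →ₗ[ℂ] ℂ, Nonzero t ∧ ∀ s : L →ₗ[ℂ] ℂ, WedgeZero t s

/-- Some tangent direction to the rank two locus extends to second order. -/
def HasSecondOrder : Prop :=
  ∃ t s r : L →ₗ[ℂ] ℂ, Indep t s ∧ WedgeZero t t ∧ WedgeZero t s ∧
    ∀ u v w z, wedge t r u v w z + wedge s s u v w z = 0

/-- The forms of rank two all vanish on a common pair with nonzero bracket. -/
def RankTwoDegenerate : Prop :=
  ∃ u v : L, ⁅u, v⁆ ≠ 0 ∧ ∀ t : L →ₗ[ℂ] ℂ, WedgeZero t t → t ⁅u, v⁆ = 0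

/-- Two elements whose adjoint maps have rank at most one do not commute. -/
def HasNoncommutingRankOne : Prop :=
  ∃ u v c d : L, (∀ w, ∃ k : ℂ, ⁅u, w⁆ = k • c) ∧ (∀ w, ∃ k : ℂ, ⁅v, w⁆ = k • d) ∧ ⁅u, v⁆ ≠ 0

variable {L}

theorem HasPencil.hasTwoRankTwo : HasPencil L → HasTwoRankTwo L :=
  fun ⟨t, s, h, ht, hs, _⟩ => ⟨t, s, h, ht, hs⟩

theorem HasPencil.hasTangent : HasPencil L → HasTangent L :=
  fun ⟨t, s, h, ht, _, hts⟩ => ⟨t, s, h, ht, hts⟩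

theorem HasRankTwo.congr (e : L ≃ₗ⁅ℂ⁆ M) : HasRankTwo M → HasRankTwo L :=
  fun ⟨t, h, h'⟩ => ⟨pull e t, h.pull e, h'.pull e⟩

theorem HasTwoRankTwo.congr (e : L ≃ₗ⁅ℂ⁆ M) : HasTwoRankTwo M → HasTwoRankTwo L :=
  fun ⟨t, s, h, ht, hs⟩ => ⟨pull e t, pull e s, h.pull e, ht.pull e, hs.pull e⟩

theorem HasPencil.congr (e : L ≃ₗ⁅ℂ⁆ M) : HasPencil M → HasPencil L :=
  fun ⟨t, s, h, ht, hs, hts⟩ =>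
    ⟨pull e t, pull e s, h.pull e, ht.pull e, hs.pull e, hts.pull e⟩

theorem HasTangent.congr (e : L ≃ₗ⁅ℂ⁆ M) : HasTangent M → HasTangent L :=
  fun ⟨t, s, h, ht, hts⟩ => ⟨pull e t, pull e s, h.pull e, ht.pull e, hts.pull e⟩

theorem HasApex.congr (e : L ≃ₗ⁅ℂ⁆ M) : HasApex M → HasApex L :=
  -- Every functional on `L` is a pullback, so quantifying over all `s` is harmless.
  fun ⟨t, h, h'⟩ => ⟨pull e t, h.pull e, fun s => by
    rw [← pull_pull_symm e s]; exact (h' _).pull e⟩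

theorem HasSecondOrder.congr (e : L ≃ₗ⁅ℂ⁆ M) : HasSecondOrder M → HasSecondOrder L :=
  fun ⟨t, s, r, h, ht, hts, h'⟩ =>
    ⟨pull e t, pull e s, pull e r, h.pull e, ht.pull e, hts.pull e, fun u v w z => by
      rw [wedge_pull, wedge_pull]; exact h' _ _ _ _⟩

/-- The witnesses are elements rather than functionals, so they move forward along `e`. -/
theorem RankTwoDegenerate.congr (e : L ≃ₗ⁅ℂ⁆ M) :
    RankTwoDegenerate L → RankTwoDegenerate M :=
  fun ⟨u, v, h, h'⟩ => ⟨e u, e v,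
    map_lie_ne_zero e h,
    fun t ht => by rw [← pull_lie]; exact h' _ (ht.pull e)⟩

theorem HasNoncommutingRankOne.congr (e : L ≃ₗ⁅ℂ⁆ M) :
    HasNoncommutingRankOne L → HasNoncommutingRankOne M := by
  have key : ∀ u c : L, (∀ w, ∃ k : ℂ, ⁅u, w⁆ = k • c) → ∀ w, ∃ k : ℂ, ⁅e u, w⁆ = k • e c := by
    intro u c h w
    obtain ⟨k, hk⟩ := h (e.symm w)
    refine ⟨k, ?_⟩
    rw [← e.apply_symm_apply w, ← LieEquiv.map_lie, hk]
    exact e.toLieHom.map_smul k c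
  rintro ⟨u, v, c, d, hu, hv, h⟩
  exact ⟨e u, e v, e c, e d, key u c hu, key v d hv, map_lie_ne_zero e h⟩

end BracketForm

/-! ### Bracket forms in coordinates -/

namespace N83

open TwoStep BracketForm

/-- This makes a form equivalent to the triple of values `t (y k)`, so nonvanishing and independence
can be checked on triples. -/
theorem exists_lie_eq_y (i : Fin 11) (k : Fin 3) : ∃ u v : N83 i, ⁅u, v⁆ = y k := by
  -- For each algebra and each `k`, a defining relation with right-hand side `y k`.
  let T : Fin 11 → Fin 3 → Fin 5 × Fin 5 :=
    ![![(0, 1), (2, 4), (3, 4)], ![(0, 4), (4, 2), (2, 3)], ![(4, 2), (0, 4), (1, 3)],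
      ![(0, 4), (4, 2), (1, 3)], ![(0, 3), (2, 4), (3, 4)], ![(0, 1), (1, 4), (2, 4)],
      ![(0, 1), (1, 4), (2, 3)], ![(0, 4), (2, 4), (3, 4)], ![(0, 4), (2, 4), (3, 4)],
      ![(0, 1), (1, 2), (0, 4)], ![(0, 4), (0, 3), (3, 4)]]
  refine ⟨x (T i k).1, x (T i k).2, ?_⟩
  refine ext' rfl fun m => ?_
  rw [lie_snd, y_snd]
  simp only [x_fst]
  fin_cases i <;> fin_cases k <;> fin_cases m <;>
    simp [T, relations, x₁, x₂, x₃, x₄, x₅, y₁, y₂, y₃]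

variable {i : Fin 11} {t s : N83 i →ₗ[ℂ] ℂ}

theorem apply_lie_eq_zero (h : ∀ k, t (y k) = 0) (u v : N83 i) : t ⁅u, v⁆ = 0 := by
  simp [apply_lie, h]

theorem nonzero_iff : Nonzero t ↔ ∃ k, t (y k) ≠ 0 := by
  constructor
  · rintro ⟨u, v, h⟩
    by_contra! h'
    exact h (apply_lie_eq_zero h' u v)
  · rintro ⟨k, h⟩
    obtain ⟨u, v, huv⟩ := exists_lie_eq_y i k
    exact ⟨u, v, by rwa [huv]⟩

theorem indep_iff :
    Indep t s ↔ ∀ α β : ℂ, (∀ k, α * t (y k) + β * s (y k) = 0) → α = 0 ∧ β = 0 := by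
  refine forall₂_congr fun α β => imp_congr_left ⟨fun h k => ?_, fun h u v => ?_⟩
  · obtain ⟨u, v, huv⟩ := exists_lie_eq_y i k
    rw [← huv]
    exact h u v
  · exact apply_lie_eq_zero (t := α • t + β • s) h u v

/-- The hypotheses are the 2×2 minors of the two coordinate triples; their vanishing makes the
triples proportional. -/
theorem not_indep (h₀₁ : t (y 0) * s (y 1) = s (y 0) * t (y 1))
    (h₀₂ : t (y 0) * s (y 2) = s (y 0) * t (y 2))
    (h₁₂ : t (y 1) * s (y 2) = s (y 1) * t (y 2)) : ¬ Indep t s := by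
  rw [indep_iff]
  intro h
  have ht : ∀ k, t (y k) = 0 := by
    intro k
    -- With coefficients `s (y k)` and `-t (y k)` the combination consists of minors, so
    -- independence would give `t (y k) = 0` for every `k`.
    refine neg_eq_zero.1 (h (s (y k)) (-t (y k)) ?_).2
    fin_cases k <;> simp only [Fin.forall_fin_succ, Fin.isValue] <;>
      refine ⟨?_, ?_, ?_, fun x => x.elim0⟩ <;> simp <;> grind
  exact one_ne_zero (h 1 0 (by simp [ht])).1

theorem indep_functional_one_two :
    Indep (functional ![0, 1, 0] : N83 i →ₗ[ℂ] ℂ) (functional ![0, 0, 1]) := by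
  rw [indep_iff]
  intro α β h
  exact ⟨by simpa [functional_y] using h 1, by simpa [functional_y] using h 2⟩

theorem nonzero_functional_two : Nonzero (functional ![0, 0, 1] : N83 i →ₗ[ℂ] ℂ) :=
  nonzero_iff.2 ⟨2, by simp [functional_y]⟩

/-! The forms `t ⁅·, ·⁆` on the individual algebras. -/

theorem apply_lie_zero (t : N83 0 →ₗ[ℂ] ℂ) (u v : N83 0) :
    t ⁅u, v⁆ =
      t (y 0) * (u.1 0 * v.1 1 - u.1 1 * v.1 0) + t (y 0) * (u.1 2 * v.1 3 - u.1 3 * v.1 2) +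
      t (y 1) * (u.1 2 * v.1 4 - u.1 4 * v.1 2) + t (y 2) * (u.1 3 * v.1 4 - u.1 4 * v.1 3) := by
  rw [apply_lie]
  simp [relations, x₁, x₂, x₃, x₄, x₅, y₁, y₂, y₃, add_assoc]
  rfl

theorem apply_lie_one (t : N83 1 →ₗ[ℂ] ℂ) (u v : N83 1) :
    t ⁅u, v⁆ =
      t (y 0) * (u.1 0 * v.1 4 - u.1 4 * v.1 0) + t (y 0) * (u.1 3 * v.1 1 - u.1 1 * v.1 3) +
      t (y 1) * (u.1 4 * v.1 2 - u.1 2 * v.1 4) + t (y 2) * (u.1 2 * v.1 3 - u.1 3 * v.1 2) := by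
  rw [apply_lie]
  simp [relations, x₁, x₂, x₃, x₄, x₅, y₁, y₂, y₃, add_assoc]
  rfl

theorem apply_lie_two (t : N83 2 →ₗ[ℂ] ℂ) (u v : N83 2) :
    t ⁅u, v⁆ =
      t (y 0) * (u.1 4 * v.1 2 - u.1 2 * v.1 4) + t (y 0) * (u.1 2 * v.1 3 - u.1 3 * v.1 2) +
      t (y 1) * (u.1 0 * v.1 4 - u.1 4 * v.1 0) + t (y 2) * (u.1 1 * v.1 3 - u.1 3 * v.1 1) := by
  rw [apply_lie]
  simp [relations, x₁, x₂, x₃, x₄, x₅, y₁, y₂, y₃, add_assoc]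
  rfl

theorem apply_lie_three (t : N83 3 →ₗ[ℂ] ℂ) (u v : N83 3) :
    t ⁅u, v⁆ =
      t (y 0) * (u.1 0 * v.1 4 - u.1 4 * v.1 0) + t (y 0) * (u.1 2 * v.1 3 - u.1 3 * v.1 2) +
      t (y 1) * (u.1 4 * v.1 2 - u.1 2 * v.1 4) + t (y 2) * (u.1 1 * v.1 3 - u.1 3 * v.1 1) := by
  rw [apply_lie]
  simp [relations, x₁, x₂, x₃, x₄, x₅, y₁, y₂, y₃, add_assoc]
  rfl

theorem apply_lie_four (t : N83 4 →ₗ[ℂ] ℂ) (u v : N83 4) :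
    t ⁅u, v⁆ =
      t (y 0) * (u.1 0 * v.1 3 - u.1 3 * v.1 0) + t (y 0) * (u.1 4 * v.1 1 - u.1 1 * v.1 4) +
      t (y 1) * (u.1 2 * v.1 4 - u.1 4 * v.1 2) + t (y 2) * (u.1 3 * v.1 4 - u.1 4 * v.1 3) := by
  rw [apply_lie]
  simp [relations, x₁, x₂, x₃, x₄, x₅, y₁, y₂, y₃, add_assoc]
  rfl

theorem apply_lie_five (t : N83 5 →ₗ[ℂ] ℂ) (u v : N83 5) :
    t ⁅u, v⁆ =
      t (y 0) * (u.1 0 * v.1 1 - u.1 1 * v.1 0) + t (y 0) * (u.1 4 * v.1 3 - u.1 3 * v.1 4) +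
      t (y 1) * (u.1 1 * v.1 4 - u.1 4 * v.1 1) + t (y 1) * (u.1 3 * v.1 2 - u.1 2 * v.1 3) +
      t (y 2) * (u.1 2 * v.1 4 - u.1 4 * v.1 2) := by
  rw [apply_lie]
  simp [relations, x₁, x₂, x₃, x₄, x₅, y₁, y₂, y₃, add_assoc]
  rfl

theorem apply_lie_six (t : N83 6 →ₗ[ℂ] ℂ) (u v : N83 6) :
    t ⁅u, v⁆ =
      t (y 0) * (u.1 0 * v.1 1 - u.1 1 * v.1 0) + t (y 0) * (u.1 4 * v.1 2 - u.1 2 * v.1 4) +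
      t (y 1) * (u.1 1 * v.1 4 - u.1 4 * v.1 1) + t (y 1) * (u.1 4 * v.1 3 - u.1 3 * v.1 4) +
      t (y 2) * (u.1 2 * v.1 3 - u.1 3 * v.1 2) := by
  rw [apply_lie]
  simp [relations, x₁, x₂, x₃, x₄, x₅, y₁, y₂, y₃, add_assoc]
  rfl

theorem apply_lie_seven (t : N83 7 →ₗ[ℂ] ℂ) (u v : N83 7) :
    t ⁅u, v⁆ =
      t (y 0) * (u.1 0 * v.1 4 - u.1 4 * v.1 0) + t (y 0) * (u.1 2 * v.1 3 - u.1 3 * v.1 2) +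
      t (y 1) * (u.1 2 * v.1 4 - u.1 4 * v.1 2) + t (y 1) * (u.1 1 * v.1 3 - u.1 3 * v.1 1) +
      t (y 2) * (u.1 3 * v.1 4 - u.1 4 * v.1 3) := by
  rw [apply_lie]
  simp [relations, x₁, x₂, x₃, x₄, x₅, y₁, y₂, y₃, add_assoc]
  rfl

theorem apply_lie_eight (t : N83 8 →ₗ[ℂ] ℂ) (u v : N83 8) :
    t ⁅u, v⁆ =
      t (y 0) * (u.1 0 * v.1 4 - u.1 4 * v.1 0) + t (y 0) * (u.1 2 * v.1 1 - u.1 1 * v.1 2) +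
      t (y 1) * (u.1 2 * v.1 4 - u.1 4 * v.1 2) + t (y 1) * (u.1 1 * v.1 3 - u.1 3 * v.1 1) +
      t (y 2) * (u.1 3 * v.1 4 - u.1 4 * v.1 3) := by
  rw [apply_lie]
  simp [relations, x₁, x₂, x₃, x₄, x₅, y₁, y₂, y₃, add_assoc]
  rfl

theorem apply_lie_nine (t : N83 9 →ₗ[ℂ] ℂ) (u v : N83 9) :
    t ⁅u, v⁆ =
      t (y 0) * (u.1 0 * v.1 1 - u.1 1 * v.1 0) + t (y 0) * (u.1 2 * v.1 3 - u.1 3 * v.1 2) +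
      t (y 1) * (u.1 1 * v.1 2 - u.1 2 * v.1 1) + t (y 1) * (u.1 3 * v.1 4 - u.1 4 * v.1 3) +
      t (y 2) * (u.1 0 * v.1 4 - u.1 4 * v.1 0) := by
  rw [apply_lie]
  simp [relations, x₁, x₂, x₃, x₄, x₅, y₁, y₂, y₃, add_assoc]
  rfl

theorem apply_lie_ten (t : N83 10 →ₗ[ℂ] ℂ) (u v : N83 10) :
    t ⁅u, v⁆ =
      t (y 0) * (u.1 0 * v.1 4 - u.1 4 * v.1 0) + t (y 0) * (u.1 3 * v.1 1 - u.1 1 * v.1 3) +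
      t (y 1) * (u.1 0 * v.1 3 - u.1 3 * v.1 0) + t (y 1) * (u.1 4 * v.1 2 - u.1 2 * v.1 4) +
      t (y 2) * (u.1 3 * v.1 4 - u.1 4 * v.1 3) + t (y 2) * (u.1 1 * v.1 2 - u.1 2 * v.1 1) := by
  rw [apply_lie]
  simp [relations, x₁, x₂, x₃, x₄, x₅, y₁, y₂, y₃, add_assoc]
  rfl

/-! The values of wedge products on quadruples of generators: the polarized Pfaffians. -/

/-- The digits in these names give the monomials of the Pfaffian: 00 is a², 01 is ab, and so on.
Only Pfaffians needed for exclusions are recorded. -/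
theorem wedge_zero_00 (t s : N83 0 →ₗ[ℂ] ℂ) :
    wedge t s (x 0) (x 1) (x 2) (x 3) = 2 * (t (y 0) * s (y 0)) := by
  simp only [wedge, apply_lie_zero, x_fst]
  simp
  ring

theorem wedge_zero_01 (t s : N83 0 →ₗ[ℂ] ℂ) :
    wedge t s (x 0) (x 1) (x 2) (x 4) = t (y 0) * s (y 1) + s (y 0) * t (y 1) := by
  simp only [wedge, apply_lie_zero, x_fst]
  simp

theorem wedge_zero_02 (t s : N83 0 →ₗ[ℂ] ℂ) :
    wedge t s (x 0) (x 1) (x 3) (x 4) = t (y 0) * s (y 2) + s (y 0) * t (y 2) := by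
  simp only [wedge, apply_lie_zero, x_fst]
  simp

theorem wedge_one_00 (t s : N83 1 →ₗ[ℂ] ℂ) :
    wedge t s (x 0) (x 4) (x 3) (x 1) = 2 * (t (y 0) * s (y 0)) := by
  simp only [wedge, apply_lie_one, x_fst]
  simp
  ring

theorem wedge_one_01 (t s : N83 1 →ₗ[ℂ] ℂ) :
    wedge t s (x 3) (x 1) (x 4) (x 2) = t (y 0) * s (y 1) + s (y 0) * t (y 1) := by
  simp only [wedge, apply_lie_one, x_fst]
  simp

theorem wedge_one_02 (t s : N83 1 →ₗ[ℂ] ℂ) :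
    wedge t s (x 0) (x 4) (x 2) (x 3) = t (y 0) * s (y 2) + s (y 0) * t (y 2) := by
  simp only [wedge, apply_lie_one, x_fst]
  simp

theorem wedge_two_01 (t s : N83 2 →ₗ[ℂ] ℂ) :
    wedge t s (x 2) (x 3) (x 0) (x 4) = t (y 0) * s (y 1) + s (y 0) * t (y 1) := by
  simp only [wedge, apply_lie_two, x_fst]
  simp

theorem wedge_two_02 (t s : N83 2 →ₗ[ℂ] ℂ) :
    wedge t s (x 4) (x 2) (x 1) (x 3) = t (y 0) * s (y 2) + s (y 0) * t (y 2) := by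
  simp only [wedge, apply_lie_two, x_fst]
  simp

theorem wedge_two_12 (t s : N83 2 →ₗ[ℂ] ℂ) :
    wedge t s (x 0) (x 4) (x 1) (x 3) = t (y 1) * s (y 2) + s (y 1) * t (y 2) := by
  simp only [wedge, apply_lie_two, x_fst]
  simp

theorem wedge_three_00 (t s : N83 3 →ₗ[ℂ] ℂ) :
    wedge t s (x 0) (x 4) (x 2) (x 3) = 2 * (t (y 0) * s (y 0)) := by
  simp only [wedge, apply_lie_three, x_fst]
  simp
  ring

theorem wedge_three_12 (t s : N83 3 →ₗ[ℂ] ℂ) :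
    wedge t s (x 4) (x 2) (x 1) (x 3) = t (y 1) * s (y 2) + s (y 1) * t (y 2) := by
  simp only [wedge, apply_lie_three, x_fst]
  simp

theorem wedge_five_00 (t s : N83 5 →ₗ[ℂ] ℂ) :
    wedge t s (x 0) (x 1) (x 4) (x 3) = 2 * (t (y 0) * s (y 0)) := by
  simp only [wedge, apply_lie_five, x_fst]
  simp
  ring

theorem wedge_five_01 (t s : N83 5 →ₗ[ℂ] ℂ) :
    wedge t s (x 0) (x 1) (x 3) (x 2) = t (y 0) * s (y 1) + s (y 0) * t (y 1) := by
  simp only [wedge, apply_lie_five, x_fst]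
  simp

theorem wedge_five_02 (t s : N83 5 →ₗ[ℂ] ℂ) :
    wedge t s (x 0) (x 1) (x 2) (x 4) = t (y 0) * s (y 2) + s (y 0) * t (y 2) := by
  simp only [wedge, apply_lie_five, x_fst]
  simp

theorem wedge_five_11 (t s : N83 5 →ₗ[ℂ] ℂ) :
    wedge t s (x 1) (x 4) (x 3) (x 2) = 2 * (t (y 1) * s (y 1)) := by
  simp only [wedge, apply_lie_five, x_fst]
  simp
  ring

theorem wedge_six_00 (t s : N83 6 →ₗ[ℂ] ℂ) :
    wedge t s (x 0) (x 1) (x 4) (x 2) = 2 * (t (y 0) * s (y 0)) := by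
  simp only [wedge, apply_lie_six, x_fst]
  simp
  ring

theorem wedge_six_01 (t s : N83 6 →ₗ[ℂ] ℂ) :
    wedge t s (x 0) (x 1) (x 4) (x 3) = t (y 0) * s (y 1) + s (y 0) * t (y 1) := by
  simp only [wedge, apply_lie_six, x_fst]
  simp

theorem wedge_six_02 (t s : N83 6 →ₗ[ℂ] ℂ) :
    wedge t s (x 0) (x 1) (x 2) (x 3) = t (y 0) * s (y 2) + s (y 0) * t (y 2) := by
  simp only [wedge, apply_lie_six, x_fst]
  simp

theorem wedge_six_12 (t s : N83 6 →ₗ[ℂ] ℂ) :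
    wedge t s (x 1) (x 4) (x 2) (x 3) = t (y 1) * s (y 2) + s (y 1) * t (y 2) := by
  simp only [wedge, apply_lie_six, x_fst]
  simp

theorem wedge_seven_00 (t s : N83 7 →ₗ[ℂ] ℂ) :
    wedge t s (x 0) (x 4) (x 2) (x 3) = 2 * (t (y 0) * s (y 0)) := by
  simp only [wedge, apply_lie_seven, x_fst]
  simp
  ring

theorem wedge_seven_11 (t s : N83 7 →ₗ[ℂ] ℂ) :
    wedge t s (x 2) (x 4) (x 1) (x 3) = 2 * (t (y 1) * s (y 1)) := by
  simp only [wedge, apply_lie_seven, x_fst]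
  simp
  ring

theorem wedge_eight_00 (t s : N83 8 →ₗ[ℂ] ℂ) :
    wedge t s (x 0) (x 4) (x 2) (x 1) = 2 * (t (y 0) * s (y 0)) := by
  simp only [wedge, apply_lie_eight, x_fst]
  simp
  ring

theorem wedge_eight_01 (t s : N83 8 →ₗ[ℂ] ℂ) :
    wedge t s (x 0) (x 4) (x 1) (x 3) = t (y 0) * s (y 1) + s (y 0) * t (y 1) := by
  simp only [wedge, apply_lie_eight, x_fst]
  simp

theorem wedge_eight_02_11 (t s : N83 8 →ₗ[ℂ] ℂ) :
    wedge t s (x 2) (x 1) (x 3) (x 4) = t (y 0) * s (y 2) + s (y 0) * t (y 2) + 2 * (t (y 1) * s (y 1)) := by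
  simp only [wedge, apply_lie_eight, x_fst]
  simp
  ring

theorem wedge_nine_00 (t s : N83 9 →ₗ[ℂ] ℂ) :
    wedge t s (x 0) (x 1) (x 2) (x 3) = 2 * (t (y 0) * s (y 0)) := by
  simp only [wedge, apply_lie_nine, x_fst]
  simp
  ring

theorem wedge_nine_02 (t s : N83 9 →ₗ[ℂ] ℂ) :
    wedge t s (x 2) (x 3) (x 0) (x 4) = t (y 0) * s (y 2) + s (y 0) * t (y 2) := by
  simp only [wedge, apply_lie_nine, x_fst]
  simp

theorem wedge_nine_11 (t s : N83 9 →ₗ[ℂ] ℂ) :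
    wedge t s (x 1) (x 2) (x 3) (x 4) = 2 * (t (y 1) * s (y 1)) := by
  simp only [wedge, apply_lie_nine, x_fst]
  simp
  ring

theorem wedge_nine_12 (t s : N83 9 →ₗ[ℂ] ℂ) :
    wedge t s (x 1) (x 2) (x 0) (x 4) = t (y 1) * s (y 2) + s (y 1) * t (y 2) := by
  simp only [wedge, apply_lie_nine, x_fst]
  simp

theorem wedge_ten_00 (t s : N83 10 →ₗ[ℂ] ℂ) :
    wedge t s (x 0) (x 4) (x 3) (x 1) = 2 * (t (y 0) * s (y 0)) := by
  simp only [wedge, apply_lie_ten, x_fst]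
  simp
  ring

theorem wedge_ten_11 (t s : N83 10 →ₗ[ℂ] ℂ) :
    wedge t s (x 0) (x 3) (x 4) (x 2) = 2 * (t (y 1) * s (y 1)) := by
  simp only [wedge, apply_lie_ten, x_fst]
  simp
  ring

theorem wedge_ten_22_01 (t s : N83 10 →ₗ[ℂ] ℂ) :
    wedge t s (x 3) (x 4) (x 1) (x 2) = 2 * (t (y 2) * s (y 2)) - (t (y 0) * s (y 1) + s (y 0) * t (y 1)) := by
  simp only [wedge, apply_lie_ten, x_fst]
  simp
  ring

/-! ### Explicit witnesses for the invariants -/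

/-- The forms dual to `y 1` and `y 2` are decomposable with a common factor, so their whole pencil
has rank two. -/
theorem hasPencil_zero : HasPencil (N83 0) := by
  refine ⟨functional ![0, 1, 0], functional ![0, 0, 1], indep_functional_one_two,
    fun u v w z => ?_, fun u v w z => ?_, fun u v w z => ?_⟩ <;>
  · simp only [wedge, apply_lie_zero, functional_y]
    simp
    ring

theorem hasPencil_one : HasPencil (N83 1) := by
  refine ⟨functional ![0, 1, 0], functional ![0, 0, 1], indep_functional_one_two,
    fun u v w z => ?_, fun u v w z => ?_, fun u v w z => ?_⟩ <;>
  · simp only [wedge, apply_lie_one, functional_y]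
    simp
    ring

theorem hasPencil_four : HasPencil (N83 4) := by
  refine ⟨functional ![0, 1, 0], functional ![0, 0, 1], indep_functional_one_two,
    fun u v w z => ?_, fun u v w z => ?_, fun u v w z => ?_⟩ <;>
  · simp only [wedge, apply_lie_four, functional_y]
    simp
    ring

theorem hasTwoRankTwo_two : HasTwoRankTwo (N83 2) := by
  refine ⟨functional ![0, 1, 0], functional ![0, 0, 1], indep_functional_one_two,
    fun u v w z => ?_, fun u v w z => ?_⟩ <;>
  · simp only [wedge, apply_lie_two, functional_y]
    simp
    ring

theorem hasTwoRankTwo_three : HasTwoRankTwo (N83 3) := by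
  refine ⟨functional ![0, 1, 0], functional ![0, 0, 1], indep_functional_one_two,
    fun u v w z => ?_, fun u v w z => ?_⟩ <;>
  · simp only [wedge, apply_lie_three, functional_y]
    simp
    ring

/-- Both relations for `y 1` contain x_5, so its form is still decomposable. -/
theorem hasTwoRankTwo_six : HasTwoRankTwo (N83 6) := by
  refine ⟨functional ![0, 1, 0], functional ![0, 0, 1], indep_functional_one_two,
    fun u v w z => ?_, fun u v w z => ?_⟩ <;>
  · simp only [wedge, apply_lie_six, functional_y]
    simp
    ring

theorem hasRankTwo_five : HasRankTwo (N83 5) := by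
  refine ⟨functional ![0, 0, 1], nonzero_functional_two, fun u v w z => ?_⟩
  simp only [wedge, apply_lie_five, functional_y]
  simp
  ring

theorem hasRankTwo_seven : HasRankTwo (N83 7) := by
  refine ⟨functional ![0, 0, 1], nonzero_functional_two, fun u v w z => ?_⟩
  simp only [wedge, apply_lie_seven, functional_y]
  simp
  ring

theorem hasRankTwo_eight : HasRankTwo (N83 8) := by
  refine ⟨functional ![0, 0, 1], nonzero_functional_two, fun u v w z => ?_⟩
  simp only [wedge, apply_lie_eight, functional_y]
  simp
  ring

theorem hasRankTwo_nine : HasRankTwo (N83 9) := by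
  refine ⟨functional ![0, 0, 1], nonzero_functional_two, fun u v w z => ?_⟩
  simp only [wedge, apply_lie_nine, functional_y]
  simp
  ring

/-- Every relation involves x_4 or x_5, so every form is killed by wedging with the form of [x_4,
x_5] = y_3. -/
theorem hasApex_four : HasApex (N83 4) := by
  refine ⟨functional ![0, 0, 1], nonzero_functional_two, fun s u v w z => ?_⟩
  simp only [wedge, apply_lie_four, functional_y]
  simp
  ring

theorem hasApex_seven : HasApex (N83 7) := by
  refine ⟨functional ![0, 0, 1], nonzero_functional_two, fun s u v w z => ?_⟩
  simp only [wedge, apply_lie_seven, functional_y]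
  simp
  ring

theorem hasTangent_three : HasTangent (N83 3) := by
  refine ⟨functional ![0, 1, 0], functional ![1, 0, 0], ?_, fun u v w z => ?_, fun u v w z => ?_⟩
  · rw [indep_iff]
    intro α β h
    exact ⟨by simpa [functional_y] using h 1, by simpa [functional_y] using h 0⟩
  all_goals
    simp only [wedge, apply_lie_three, functional_y]
    simp
    ring

theorem hasTangent_five : HasTangent (N83 5) := by
  refine ⟨functional ![0, 0, 1], functional ![0, 1, 0], indep_functional_one_two.symm,
    fun u v w z => ?_, fun u v w z => ?_⟩ <;>
  · simp only [wedge, apply_lie_five, functional_y]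
    simp
    ring

theorem hasTangent_seven : HasTangent (N83 7) := by
  refine ⟨functional ![0, 0, 1], functional ![0, 1, 0], indep_functional_one_two.symm,
    fun u v w z => ?_, fun u v w z => ?_⟩ <;>
  · simp only [wedge, apply_lie_seven, functional_y]
    simp
    ring

theorem hasTangent_eight : HasTangent (N83 8) := by
  refine ⟨functional ![0, 0, 1], functional ![0, 1, 0], indep_functional_one_two.symm,
    fun u v w z => ?_, fun u v w z => ?_⟩ <;>
  · simp only [wedge, apply_lie_eight, functional_y]
    simp
    ring

theorem hasSecondOrder_eight : HasSecondOrder (N83 8) := by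
  -- The only obstruction is the Pfaffian ac + b²: the value -2 makes `t ∧ r` cancel the 2 from `s ∧
  -- s`.
  refine ⟨functional ![0, 0, 1], functional ![0, 1, 0], functional ![-2, 0, 0],
    indep_functional_one_two.symm, fun u v w z => ?_, fun u v w z => ?_, fun u v w z => ?_⟩ <;>
  · simp only [wedge, apply_lie_eight, functional_y]
    simp
    ring

theorem hasNoncommutingRankOne_zero : HasNoncommutingRankOne (N83 0) := by
  -- x_1 and x_2 occur in no relation other than [x_1, x_2] = y_1.
  refine ⟨x 0, x 1, y 0, y 0, fun w => ⟨w.1 1, ?_⟩, fun w => ⟨-w.1 0, ?_⟩, fun h => ?_⟩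
  · refine ext' (smul_zero _).symm fun k => ?_
    rw [lie_snd, smul_snd, Pi.smul_apply, y_snd]
    simp only [x_fst]
    fin_cases k <;> simp [relations, x₁, x₂, x₃, x₄, x₅, y₁, y₂, y₃]
  · refine ext' (smul_zero _).symm fun k => ?_
    rw [lie_snd, smul_snd, Pi.smul_apply, y_snd]
    simp only [x_fst]
    fin_cases k <;> simp [relations, x₁, x₂, x₃, x₄, x₅, y₁, y₂, y₃]
  · have h' := congrArg (fun u : N83 0 => u.2 0) h
    simp only [lie_snd, x_fst, zero_snd] at h'
    simp [relations, x₁, x₂, x₃, x₄, x₅, y₁, y₂, y₃] at h'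

/-- An element of the second algebra whose adjoint map has rank at most one lies in the span of
the first two generators and the center. -/
theorem fst_eq_zero_of_rankOne_one {u c : N83 1} (h : ∀ w, ∃ k : ℂ, ⁅u, w⁆ = k • c) :
    u.1 2 = 0 ∧ u.1 3 = 0 ∧ u.1 4 = 0 := by
  have key : ∀ (w z : N83 1) (m n : Fin 3), (⁅u, w⁆ : N83 1).2 m * (⁅u, z⁆ : N83 1).2 n =
      (⁅u, w⁆ : N83 1).2 n * (⁅u, z⁆ : N83 1).2 m := by
    intro w z m n
    obtain ⟨k, hk⟩ := h w
    obtain ⟨l, hl⟩ := h z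
    simp only [hk, hl, smul_snd, Pi.smul_apply, smul_eq_mul]
    ring
  -- Each of these three minors of the adjoint map reduces, up to sign, to the square of one
  -- coordinate of `u`.
  have h₂ := key (x 3) (x 4) 1 2
  have h₃ := key (x 1) (x 2) 0 2
  have h₄ := key (x 0) (x 2) 0 1
  simp only [lie_snd, x_fst] at h₂ h₃ h₄
  simp [relations, x₁, x₂, x₃, x₄, x₅, y₁, y₂, y₃] at h₂ h₃ h₄
  exact ⟨h₂, h₃, h₄⟩

theorem not_hasNoncommutingRankOne_one : ¬ HasNoncommutingRankOne (N83 1) := by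
  rintro ⟨u, v, c, d, hu, hv, h⟩
  obtain ⟨hu₂, hu₃, hu₄⟩ := fst_eq_zero_of_rankOne_one hu
  obtain ⟨hv₂, hv₃, hv₄⟩ := fst_eq_zero_of_rankOne_one hv
  refine h (ext' rfl fun k => ?_)
  rw [lie_snd, zero_snd]
  fin_cases k <;>
    simp [relations, x₁, x₂, x₃, x₄, x₅, y₁, y₂, y₃, hu₂, hu₃, hu₄, hv₂, hv₃, hv₄]

/-! ### Exclusions by Pfaffians -/

/-- Polarizing a², ab, ac against (1, 0, 0) reads off all three coordinates of `t`. -/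
theorem not_hasApex_zero : ¬ HasApex (N83 0) := by
  rintro ⟨t, ht, h⟩
  have h₀ := (wedge_zero_00 t (functional ![1, 0, 0])).symm.trans (h _ _ _ _ _)
  have h₁ := (wedge_zero_01 t (functional ![1, 0, 0])).symm.trans (h _ _ _ _ _)
  have h₂ := (wedge_zero_02 t (functional ![1, 0, 0])).symm.trans (h _ _ _ _ _)
  simp [functional_y] at h₀ h₁ h₂
  obtain ⟨k, hk⟩ := nonzero_iff.1 ht
  fin_cases k <;> exact hk ‹_›

theorem not_hasApex_one : ¬ HasApex (N83 1) := by
  rintro ⟨t, ht, h⟩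
  have h₀ := (wedge_one_00 t (functional ![1, 0, 0])).symm.trans (h _ _ _ _ _)
  have h₁ := (wedge_one_01 t (functional ![1, 0, 0])).symm.trans (h _ _ _ _ _)
  have h₂ := (wedge_one_02 t (functional ![1, 0, 0])).symm.trans (h _ _ _ _ _)
  simp [functional_y] at h₀ h₁ h₂
  obtain ⟨k, hk⟩ := nonzero_iff.1 ht
  fin_cases k <;> exact hk ‹_›

theorem not_hasApex_five : ¬ HasApex (N83 5) := by
  rintro ⟨t, ht, h⟩
  have h₀ := (wedge_five_00 t (functional ![1, 0, 0])).symm.trans (h _ _ _ _ _)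
  have h₁ := (wedge_five_01 t (functional ![1, 0, 0])).symm.trans (h _ _ _ _ _)
  have h₂ := (wedge_five_02 t (functional ![1, 0, 0])).symm.trans (h _ _ _ _ _)
  simp [functional_y] at h₀ h₁ h₂
  obtain ⟨k, hk⟩ := nonzero_iff.1 ht
  fin_cases k <;> exact hk ‹_›

theorem not_hasApex_eight : ¬ HasApex (N83 8) := by
  rintro ⟨t, ht, h⟩
  have h₀ := (wedge_eight_00 t (functional ![1, 0, 0])).symm.trans (h _ _ _ _ _)
  have h₁ := (wedge_eight_01 t (functional ![1, 0, 0])).symm.trans (h _ _ _ _ _)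
  have h₂ := (wedge_eight_02_11 t (functional ![1, 0, 0])).symm.trans (h _ _ _ _ _)
  simp [functional_y] at h₀ h₁ h₂
  obtain ⟨k, hk⟩ := nonzero_iff.1 ht
  fin_cases k <;> exact hk ‹_›

/-- The triples of all rank-two forms then lie on the single line a = b = 0. -/
theorem not_hasTwoRankTwo_of_forall {i : Fin 11}
    (h : ∀ t : N83 i →ₗ[ℂ] ℂ, WedgeZero t t → t (y 0) = 0 ∧ t (y 1) = 0) :
    ¬ HasTwoRankTwo (N83 i) := by
  rintro ⟨t, s, hi, ht, hs⟩
  obtain ⟨ht₀, ht₁⟩ := h t ht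
  obtain ⟨hs₀, hs₁⟩ := h s hs
  exact not_indep (by simp [*]) (by simp [*]) (by simp [*]) hi

theorem rankTwo_five {t : N83 5 →ₗ[ℂ] ℂ} (h : WedgeZero t t) :
    t (y 0) = 0 ∧ t (y 1) = 0 := by
  have h₀ := (wedge_five_00 t t).symm.trans (h _ _ _ _)
  have h₁ := (wedge_five_11 t t).symm.trans (h _ _ _ _)
  simp only [mul_eq_zero, OfNat.ofNat_ne_zero, or_self, false_or] at h₀
  simp at h₁
  exact ⟨h₀, h₁⟩

theorem rankTwo_seven {t : N83 7 →ₗ[ℂ] ℂ} (h : WedgeZero t t) :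
    t (y 0) = 0 ∧ t (y 1) = 0 := by
  have h₀ := (wedge_seven_00 t t).symm.trans (h _ _ _ _)
  have h₁ := (wedge_seven_11 t t).symm.trans (h _ _ _ _)
  simp only [mul_eq_zero, OfNat.ofNat_ne_zero, or_self, false_or] at h₀
  simp at h₁
  exact ⟨h₀, h₁⟩

theorem rankTwo_eight {t : N83 8 →ₗ[ℂ] ℂ} (h : WedgeZero t t) :
    t (y 0) = 0 ∧ t (y 1) = 0 := by
  have h₀ := (wedge_eight_00 t t).symm.trans (h _ _ _ _)
  have h₁ := (wedge_eight_02_11 t t).symm.trans (h _ _ _ _)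
  simp only [mul_eq_zero, OfNat.ofNat_ne_zero, or_self, false_or] at h₀
  simp [h₀] at h₁
  exact ⟨h₀, h₁⟩

theorem rankTwo_nine {t : N83 9 →ₗ[ℂ] ℂ} (h : WedgeZero t t) :
    t (y 0) = 0 ∧ t (y 1) = 0 := by
  have h₀ := (wedge_nine_00 t t).symm.trans (h _ _ _ _)
  have h₁ := (wedge_nine_11 t t).symm.trans (h _ _ _ _)
  simp only [mul_eq_zero, OfNat.ofNat_ne_zero, or_self, false_or] at h₀
  simp at h₁
  exact ⟨h₀, h₁⟩

theorem rankTwo_ten {t : N83 10 →ₗ[ℂ] ℂ} (h : WedgeZero t t) (k : Fin 3) : t (y k) = 0 := by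
  have h₀ := (wedge_ten_00 t t).symm.trans (h _ _ _ _)
  have h₁ := (wedge_ten_11 t t).symm.trans (h _ _ _ _)
  have h₂ := (wedge_ten_22_01 t t).symm.trans (h _ _ _ _)
  simp only [mul_eq_zero, OfNat.ofNat_ne_zero, or_self, false_or] at h₀ h₁
  simp [h₀, h₁] at h₂
  fin_cases k <;> assumption

theorem not_hasRankTwo_ten : ¬ HasRankTwo (N83 10) := by
  rintro ⟨t, ht, h⟩
  obtain ⟨k, hk⟩ := nonzero_iff.1 ht
  exact hk (rankTwo_ten h k)

/-- One factor of `a * b` vanishes, killing one term of the polarized equation and hence the other.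
Applied to a Pfaffian that is a product of two coordinates, it yields a vanishing minor. -/
theorem eq_of_polar_eq_zero {a b c d : ℂ} (h : a * b = 0) (h' : a * d + c * b = 0) :
    a * d = c * b := by
  rcases mul_eq_zero.1 h with rfl | rfl <;> simp_all

/-- The Pfaffians ab, ac, bc give all three minors, so a tangent direction `s` is proportional to
`t`. -/
theorem not_hasTangent_two : ¬ HasTangent (N83 2) := by
  rintro ⟨t, s, hi, ht, hts⟩
  have h₁ := (wedge_two_01 t t).symm.trans (ht _ _ _ _)
  have h₁' := (wedge_two_01 t s).symm.trans (hts _ _ _ _)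
  have h₂ := (wedge_two_02 t t).symm.trans (ht _ _ _ _)
  have h₂' := (wedge_two_02 t s).symm.trans (hts _ _ _ _)
  have h₃ := (wedge_two_12 t t).symm.trans (ht _ _ _ _)
  have h₃' := (wedge_two_12 t s).symm.trans (hts _ _ _ _)
  rw [← two_mul, mul_eq_zero_iff_left two_ne_zero] at h₁ h₂ h₃
  exact not_indep (eq_of_polar_eq_zero h₁ h₁') (eq_of_polar_eq_zero h₂ h₂')
    (eq_of_polar_eq_zero h₃ h₃') hi

theorem not_hasTangent_six : ¬ HasTangent (N83 6) := by
  rintro ⟨t, s, hi, ht, hts⟩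
  have h₁ := (wedge_six_01 t t).symm.trans (ht _ _ _ _)
  have h₁' := (wedge_six_01 t s).symm.trans (hts _ _ _ _)
  have h₂ := (wedge_six_02 t t).symm.trans (ht _ _ _ _)
  have h₂' := (wedge_six_02 t s).symm.trans (hts _ _ _ _)
  have h₃ := (wedge_six_12 t t).symm.trans (ht _ _ _ _)
  have h₃' := (wedge_six_12 t s).symm.trans (hts _ _ _ _)
  rw [← two_mul, mul_eq_zero_iff_left two_ne_zero] at h₁ h₂ h₃
  exact not_indep (eq_of_polar_eq_zero h₁ h₁') (eq_of_polar_eq_zero h₂ h₂')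
    (eq_of_polar_eq_zero h₃ h₃') hi

theorem not_hasTangent_nine : ¬ HasTangent (N83 9) := by
  rintro ⟨t, s, hi, ht, hts⟩
  obtain ⟨h₀, h₁⟩ := rankTwo_nine ht
  have h₂ := (wedge_nine_02 t s).symm.trans (hts _ _ _ _)
  have h₃ := (wedge_nine_12 t s).symm.trans (hts _ _ _ _)
  simp only [h₀, h₁, zero_mul, zero_add] at h₂ h₃
  exact not_indep (by simp [h₀, h₁]) (by rw [h₀, h₂, zero_mul]) (by rw [h₁, h₃, zero_mul]) hi

theorem rankTwo_three {t : N83 3 →ₗ[ℂ] ℂ} (h : WedgeZero t t) : t (y 0) = 0 := by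
  simpa using (wedge_three_00 t t).symm.trans (h _ _ _ _)

theorem rankTwo_six {t : N83 6 →ₗ[ℂ] ℂ} (h : WedgeZero t t) : t (y 0) = 0 := by
  simpa using (wedge_six_00 t t).symm.trans (h _ _ _ _)

theorem not_hasPencil_three : ¬ HasPencil (N83 3) := by
  rintro ⟨t, s, hi, ht, hs, hts⟩
  have h₃ := (wedge_three_12 t t).symm.trans (ht _ _ _ _)
  have h₃' := (wedge_three_12 t s).symm.trans (hts _ _ _ _)
  rw [← two_mul, mul_eq_zero_iff_left two_ne_zero] at h₃
  have ht₀ := rankTwo_three ht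
  have hs₀ := rankTwo_three hs
  exact not_indep (by simp [ht₀, hs₀]) (by simp [ht₀, hs₀]) (eq_of_polar_eq_zero h₃ h₃') hi

/-- At a rank-two point a = b = 0, so in the Pfaffians a² and b² the `r` term drops out and the
first two coordinates of `s` vanish too. -/
theorem not_hasSecondOrder_five : ¬ HasSecondOrder (N83 5) := by
  rintro ⟨t, s, r, hi, ht, hts, h⟩
  obtain ⟨ht₀, ht₁⟩ := rankTwo_five ht
  have h₀ := h (x 0) (x 1) (x 4) (x 3)
  have h₁ := h (x 1) (x 4) (x 3) (x 2)
  rw [wedge_five_00, wedge_five_00, ht₀] at h₀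
  rw [wedge_five_11, wedge_five_11, ht₁] at h₁
  simp at h₀ h₁
  exact not_indep (by simp [*]) (by simp [*]) (by simp [*]) hi

theorem rankTwoDegenerate_three : RankTwoDegenerate (N83 3) := by
  obtain ⟨u, v, h⟩ := exists_lie_eq_y 3 0
  exact ⟨u, v, by rw [h]; exact y_ne_zero 0, fun t ht => by rw [h]; exact rankTwo_three ht⟩

theorem rankTwoDegenerate_six : RankTwoDegenerate (N83 6) := by
  obtain ⟨u, v, h⟩ := exists_lie_eq_y 6 0
  exact ⟨u, v, by rw [h]; exact y_ne_zero 0, fun t ht => by rw [h]; exact rankTwo_six ht⟩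

/-- All three coordinate functionals give rank-two forms, and together they detect every nonzero
bracket. -/
theorem not_rankTwoDegenerate_two : ¬ RankTwoDegenerate (N83 2) := by
  rintro ⟨u, v, h, h'⟩
  refine h (ext' rfl fun k => ?_)
  rw [zero_snd]
  have := h' (functional (Pi.single k 1)) fun u v w z => by
    simp only [wedge, apply_lie_two, functional_y]
    fin_cases k <;> simp <;> ring
  simpa [functional, Pi.single_apply] using this

theorem not_hasTwoRankTwo {i : Fin 11} (hi : i ∈ ({5, 7, 8, 9, 10} : Finset (Fin 11))) :
    ¬ HasTwoRankTwo (N83 i) := by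
  refine not_hasTwoRankTwo_of_forall fun t ht => ?_
  fin_cases hi
  exacts [rankTwo_five ht, rankTwo_seven ht, rankTwo_eight ht, rankTwo_nine ht,
    ⟨rankTwo_ten ht 0, rankTwo_ten ht 1⟩]

/-! ### Values of the invariants and separation of the algebras -/

theorem hasPencil_iff (i : Fin 11) :
    HasPencil (N83 i) ↔ i ∈ ({0, 1, 4} : Finset (Fin 11)) := by
  have h := fun hi (h : HasPencil (N83 i)) => not_hasTwoRankTwo (i := i) hi h.hasTwoRankTwo
  revert h
  fin_cases i <;> intro h
  exacts [iff_of_true hasPencil_zero (by decide), iff_of_true hasPencil_one (by decide),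
    iff_of_false (fun h => not_hasTangent_two h.hasTangent) (by decide),
    iff_of_false not_hasPencil_three (by decide), iff_of_true hasPencil_four (by decide),
    iff_of_false (h (by decide)) (by decide),
    iff_of_false (fun h => not_hasTangent_six h.hasTangent) (by decide),
    iff_of_false (h (by decide)) (by decide), iff_of_false (h (by decide)) (by decide),
    iff_of_false (h (by decide)) (by decide), iff_of_false (h (by decide)) (by decide)]

theorem hasTwoRankTwo_iff (i : Fin 11) :
    HasTwoRankTwo (N83 i) ↔ i ∈ ({0, 1, 2, 3, 4, 6} : Finset (Fin 11)) := by
  refine ⟨fun h => ?_, fun hi => ?_⟩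
  · by_contra hi
    exact not_hasTwoRankTwo (by clear h; revert i; decide) h
  · fin_cases hi
    exacts [hasPencil_zero.hasTwoRankTwo, hasPencil_one.hasTwoRankTwo, hasTwoRankTwo_two,
      hasTwoRankTwo_three, hasPencil_four.hasTwoRankTwo, hasTwoRankTwo_six]

/-- Here and below, an invariant is evaluated only on a set of algebras sufficient for the final
separation. -/
theorem hasApex_iff {i : Fin 11} (hi : i ∈ ({0, 1, 4, 5, 7, 8} : Finset (Fin 11))) :
    HasApex (N83 i) ↔ i ∈ ({4, 7} : Finset (Fin 11)) := by
  fin_cases hi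
  exacts [iff_of_false not_hasApex_zero (by decide), iff_of_false not_hasApex_one (by decide),
    iff_of_true hasApex_four (by decide), iff_of_false not_hasApex_five (by decide),
    iff_of_true hasApex_seven (by decide), iff_of_false not_hasApex_eight (by decide)]

theorem hasTangent_iff {i : Fin 11} (hi : i ∈ ({3, 5, 6, 7, 8, 9} : Finset (Fin 11))) :
    HasTangent (N83 i) ↔ i ∈ ({3, 5, 7, 8} : Finset (Fin 11)) := by
  fin_cases hi
  exacts [iff_of_true hasTangent_three (by decide), iff_of_true hasTangent_five (by decide),
    iff_of_false not_hasTangent_six (by decide), iff_of_true hasTangent_seven (by decide),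
    iff_of_true hasTangent_eight (by decide), iff_of_false not_hasTangent_nine (by decide)]

theorem hasRankTwo_iff {i : Fin 11} (hi : i ∈ ({5, 7, 8, 9, 10} : Finset (Fin 11))) :
    HasRankTwo (N83 i) ↔ i ≠ 10 := by
  fin_cases hi
  exacts [iff_of_true hasRankTwo_five (by decide), iff_of_true hasRankTwo_seven (by decide),
    iff_of_true hasRankTwo_eight (by decide), iff_of_true hasRankTwo_nine (by decide),
    iff_of_false not_hasRankTwo_ten (by decide)]

theorem hasSecondOrder_iff {i : Fin 11} (hi : i ∈ ({5, 8} : Finset (Fin 11))) :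
    HasSecondOrder (N83 i) ↔ i = 8 := by
  fin_cases hi
  exacts [iff_of_false not_hasSecondOrder_five (by decide),
    iff_of_true hasSecondOrder_eight (by decide)]

theorem rankTwoDegenerate_iff {i : Fin 11} (hi : i ∈ ({2, 3, 6} : Finset (Fin 11))) :
    RankTwoDegenerate (N83 i) ↔ i ≠ 2 := by
  fin_cases hi
  exacts [iff_of_false not_rankTwoDegenerate_two (by decide),
    iff_of_true rankTwoDegenerate_three (by decide), iff_of_true rankTwoDegenerate_six (by decide)]

theorem hasNoncommutingRankOne_iff {i : Fin 11} (hi : i ∈ ({0, 1} : Finset (Fin 11))) :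
    HasNoncommutingRankOne (N83 i) ↔ i = 0 := by
  fin_cases hi
  exacts [iff_of_true hasNoncommutingRankOne_zero (by decide),
    iff_of_false not_hasNoncommutingRankOne_one (by decide)]

set_option synthInstance.maxSize 1000 in
-- Pencils and pairs of rank-two forms split the indices into {0, 1, 4}, {2, 3, 6} and {5, 7, 8, 9,
-- 10}. In the first class the apex isolates 4 and rank-one elements separate 0 from 1. In the
-- second, degeneracy isolates 2 and tangents separate 3 from 6. In the third, 10 has no rank-two
-- form, 9 no tangent, 7 has an apex, and second order separates 5 from 8.
theorem eq_of_lieEquiv (i j : Fin 11) (e : N83 i ≃ₗ⁅ℂ⁆ N83 j) : i = j := by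
  have h₁ : i ∈ ({0, 1, 4} : Finset (Fin 11)) ↔ j ∈ ({0, 1, 4} : Finset (Fin 11)) := by
    rw [← hasPencil_iff, ← hasPencil_iff]
    exact ⟨.congr e.symm, .congr e⟩
  have h₂ : i ∈ ({0, 1, 2, 3, 4, 6} : Finset (Fin 11)) ↔
      j ∈ ({0, 1, 2, 3, 4, 6} : Finset (Fin 11)) := by
    rw [← hasTwoRankTwo_iff, ← hasTwoRankTwo_iff]
    exact ⟨.congr e.symm, .congr e⟩
  have h₃ : i ∈ ({5, 7, 8, 9, 10} : Finset (Fin 11)) →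
      j ∈ ({5, 7, 8, 9, 10} : Finset (Fin 11)) → (i ≠ 10 ↔ j ≠ 10) := fun hi hj => by
    rw [← hasRankTwo_iff hi, ← hasRankTwo_iff hj]
    exact ⟨.congr e.symm, .congr e⟩
  have h₄ : i ∈ ({3, 5, 6, 7, 8, 9} : Finset (Fin 11)) →
      j ∈ ({3, 5, 6, 7, 8, 9} : Finset (Fin 11)) →
      (i ∈ ({3, 5, 7, 8} : Finset (Fin 11)) ↔ j ∈ ({3, 5, 7, 8} : Finset (Fin 11))) :=
    fun hi hj => by
      rw [← hasTangent_iff hi, ← hasTangent_iff hj]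
      exact ⟨.congr e.symm, .congr e⟩
  have h₅ : i ∈ ({0, 1, 4, 5, 7, 8} : Finset (Fin 11)) →
      j ∈ ({0, 1, 4, 5, 7, 8} : Finset (Fin 11)) →
      (i ∈ ({4, 7} : Finset (Fin 11)) ↔ j ∈ ({4, 7} : Finset (Fin 11))) := fun hi hj => by
    rw [← hasApex_iff hi, ← hasApex_iff hj]
    exact ⟨.congr e.symm, .congr e⟩
  have h₆ : i ∈ ({5, 8} : Finset (Fin 11)) → j ∈ ({5, 8} : Finset (Fin 11)) →
      (i = 8 ↔ j = 8) := fun hi hj => by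
    rw [← hasSecondOrder_iff hi, ← hasSecondOrder_iff hj]
    exact ⟨.congr e.symm, .congr e⟩
  have h₇ : i ∈ ({2, 3, 6} : Finset (Fin 11)) → j ∈ ({2, 3, 6} : Finset (Fin 11)) →
      (i ≠ 2 ↔ j ≠ 2) := fun hi hj => by
    rw [← rankTwoDegenerate_iff hi, ← rankTwoDegenerate_iff hj]
    exact ⟨.congr e, .congr e.symm⟩
  have h₈ : i ∈ ({0, 1} : Finset (Fin 11)) → j ∈ ({0, 1} : Finset (Fin 11)) →
      (i = 0 ↔ j = 0) := fun hi hj => by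
    rw [← hasNoncommutingRankOne_iff hi, ← hasNoncommutingRankOne_iff hj]
    exact ⟨.congr e, .congr e.symm⟩
  -- What remains is a decidable statement about pairs of indices.
  clear e
  revert i j
  decide

end N83

theorem mainTheorem5 :
    (∀ i : Fin 11,
      Module.finrank ℂ (N83 i) = 8 ∧
      LieModule.nilpotencyLength (N83 i) (N83 i) = 2 ∧
      Module.finrank ℂ (LieAlgebra.center ℂ (N83 i)) = 3) ∧
    ∀ i j : Fin 11, i ≠ j → IsEmpty (N83 i ≃ₗ⁅ℂ⁆ N83 j) :=
  ⟨fun i => ⟨TwoStep.finrank_eq, TwoStep.nilpotencyLength_eq_two (N83.exists_lie_ne_zero i),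
    TwoStep.finrank_center (N83.fst_eq_zero_of_lie_eq_zero i)⟩,
    fun _ _ hij => ⟨fun e => hij (N83.eq_of_lieEquiv _ _ e)⟩⟩
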